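/- Lemma (sum of squares for symmetrized simple tabulation hashing). There is a universal constant $L > 0$ such that the following holds. Let $\Sigma$ be a finite alphabet, $c \ge 1$ an integer, $m = 2^l$ with $l \ge 0$ an integer, and identify $[m] = \{0, \dots, m-1\}$ with $(\mathbb Z/2\mathbb Z)^l$, so that addition $\oplus$ is bitwise XOR. Let $T \colon [c] \times \Sigma \to [m]$ and $T_\varepsilon \colon [c] \times \Sigma \to \{-1, 1\}$ be fully random tables (in each table the entries are independent and uniformly distributed) that are independent of each other. Define the simple tabulation function $h(\alpha_0, \dots, \alpha_{c-1}) = \bigoplus_{i \in [c]} T(i, \alpha_i)$ and the simple tabulation sign function $\varepsilon(\alpha_0, \dots, \alpha_{c-1}) = \prod_{i \in [c]} T_\varepsilon(i, \alpha_i)$ on $\Sigma^c$. Then for every value function $v \colon \Sigma^c \times [m] \to \mathbb R$ and every real number $p \ge 2$, $$\left\| \sum_{j \in [m]} \Big( \sum_{x \in \Sigma^c} \varepsilon(x)\, v(x, h(x) \oplus j) \Big)^2 \right\|_p \le \left( \frac{L c \max\{p, \log m\}}{\log\!\left( \frac{e^2 m \sum_{x \in \Sigma^c} \|v[x]\|_2^2}{\sum_{x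 \in \Sigma^c} \|v[x]\|_1^2} \right)} \right)^{c} \sum_{x \in \Sigma^c} \|v[x]\|_2^2 ,$$ where $\|X\|_p = \mathbb E[|X|^p]^{1/p}$ and $\|v[x]\|_q = \big(\sum_{j \in [m]} |v(x,j)|^q\big)^{1/q}$. (If $v = 0$ the right-hand side is read as $0$.) -/

import Mathlib

open MeasureTheory ProbabilityTheory
open scoped ENNReal

namespace Tabulation

/-- The range `[m]` with `m = 2 ^ l`, identified with the group `(ℤ/2ℤ)^l`, so that its addition
is bitwise XOR. -/
abbrev HashRange (l : ℕ) : Type := Fin l → ZMod 2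

/-- Keys with `c` characters over the alphabet `σ`. -/
abbrev Key (c : ℕ) (σ : Type*) : Type _ := Fin c → σ

/-- `T` is a fully random table: its entries are random variables on `(Ω, μ)` that are mutually
independent and uniformly distributed on the finite set `R`. -/
structure IsFullyRandom {ι R Ω : Type*} [Fintype R] [MeasurableSpace R] [MeasurableSpace Ω]
    (T : ι → Ω → R) (μ : Measure Ω) : Prop where
  measurable : ∀ i, Measurable (T i)
  indep : iIndepFun T μ
  uniform : ∀ i r, μ (T i ⁻¹' {r}) = (Fintype.card R : ℝ≥0∞)⁻¹

/-- The simple tabulation function of a table: `h(α₀, …, α_{c-1}) = T(0, α₀) ⊕ ⋯ ⊕ T(c-1, α_{c-1})`. -/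
def simpleTab {c l : ℕ} {σ : Type*} (T : Fin c × σ → HashRange l) (x : Key c σ) : HashRange l :=
  ∑ i, T (i, x i)

/-- The simple tabulation sign function of a table of signs:
`ε(α₀, …, α_{c-1}) = E(0, α₀) ⋯ E(c-1, α_{c-1})`. The group `ℤˣ` is `{-1, 1}`. -/
def simpleTabSign {c : ℕ} {σ : Type*} (E : Fin c × σ → ℤˣ) (x : Key c σ) : ℤˣ :=
  ∏ i, E (i, x i)

/-- `‖v[x]‖_q`, the `ℓ^q` norm of the value function `v` restricted to the key `x`. -/
noncomputable def keyNorm {c l : ℕ} {σ : Type*} (q : ℝ≥0∞) [Fact (1 ≤ q)]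
    (v : Key c σ → HashRange l → ℝ) (x : Key c σ) : ℝ :=
  ‖WithLp.toLp q (v x)‖

/-- `∑_j (∑_x ε(x) v(x, h(x) ⊕ j))²`, for the hash table `T` and the sign table `E`. -/
noncomputable def sumSquares {c l : ℕ} {σ : Type*} [Fintype σ]
    (v : Key c σ → HashRange l → ℝ) (T : Fin c × σ → HashRange l) (E : Fin c × σ → ℤˣ) : ℝ :=
  ∑ j : HashRange l, (∑ x : Key c σ, ((simpleTabSign E x : ℤ) : ℝ) * v x (simpleTab T x + j)) ^ 2

end Tabulation

/-! By Parseval over the Walsh characters `χ_s` of `(ℤ/2ℤ)^l`, the sum of squares is the average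
over `s` of the squared chaos `∑_x ∏_i φ_s(θ_i(x_i)) v̂_s(x)`, where `θ_i(α)` is the pair of sign
and hash entries and `φ_s(e, h) = e χ_s(h)`. The `φ_s` are odd, valued in `±1` and pairwise
orthogonal. The quantity `∑_x v̂_s(x)²` averages to `B = ∑ ‖v[x]‖₂²` over `s` and never exceeds `A =
∑ ‖v[x]‖₁²`.

For one position (`expect_quadForm_rpow_le`), signed vectors are added one at a time while tracking
the `p`-th moment of `K` plus a weighted quadratic form. The cross term has mean zero, and
orthogonality puts a factor `1/m`, `m = 2^l`, into its variance. Its effect is absorbed by raising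
the weight at `s` in proportion to the squared norm of the new vector at `s`; the bound `A` keeps
all weights below 2. The few vectors too large for this are handled by Cauchy–Schwarz. The result is
the bound `16p(B/u + e^u A/m)` for every `0 < u ≤ p`.

Induction on `c` (`expect_chaos_rpow_le`) conditions on the first position. The one-position bound
controls the new average, and a Khintchine inequality controls the new maximum over `s`, at the
price of a constant because `m ≤ e^p`. Finally `u` of order `log(e² m B / A) / c` balances the two
terms (`exists_parameter`). -/

namespace Tabulation

open Finset Function
open scoped BigOperators

/-- A family of symmetric sign-valued functions on a finite set with the uniform distribution that
are pairwise orthogonal. -/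
structure IsSymmOrthonormal {S Θ : Type*} [Fintype Θ] [InvolutiveNeg Θ] (φ : S → Θ → ℝ) :
    Prop where
  map_neg : ∀ s t, φ s (-t) = -φ s t
  sq_eq_one : ∀ s t, φ s t ^ 2 = 1
  orthogonal : ∀ s s', s ≠ s' → 𝔼 t, φ s t * φ s' t = 0

/-- The average over `s` of `∑ y, F s y ^ 2`, with weights `q`. -/
noncomputable def quadForm {S Y : Type*} [Fintype S] [Fintype Y] (q : S → ℝ) (F : S → Y → ℝ) : ℝ :=
  𝔼 s, q s * ∑ y, F s y ^ 2

/-! ### Adding one randomly signed vector to a weighted quadratic form -/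

section OneStep

variable {S Y Θ : Type*} [Fintype S] [Fintype Y] [Fintype Θ]

lemma quadForm_nonneg {q : S → ℝ} (hq : ∀ s, 0 ≤ q s) (F : S → Y → ℝ) : 0 ≤ quadForm q F :=
  expect_nonneg fun s _ => mul_nonneg (hq s) (sum_nonneg fun _ _ => sq_nonneg _)

lemma quadForm_mono {q q' : S → ℝ} (h : ∀ s, q s ≤ q' s) (F : S → Y → ℝ) :
    quadForm q F ≤ quadForm q' F :=
  expect_le_expect fun s _ => mul_le_mul_of_nonneg_right (h s) (sum_nonneg fun _ _ => sq_nonneg _)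

lemma quadForm_const (r : ℝ) (F : S → Y → ℝ) :
    quadForm (fun _ => r) F = r * quadForm (fun _ => 1) F := by
  simp only [quadForm, one_mul, mul_expect]

/-- Since `φ² = 1`, only the cross term depends on the signs. -/
lemma quadForm_add_signed {φ : S → ℝ} (hφ : ∀ s, φ s ^ 2 = 1) (q : S → ℝ) (F w : S → Y → ℝ) :
    quadForm q (fun s y => F s y + φ s * w s y) =
      quadForm q F + 2 * 𝔼 s, φ s * (q s * ∑ y, F s y * w s y) + quadForm q w := by
  simp only [quadForm, mul_expect, ← expect_add_distrib]
  refine expect_congr rfl fun s _ => ?_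
  have : ∑ y, (F s y + φ s * w s y) ^ 2 =
      ∑ y, F s y ^ 2 + 2 * φ s * ∑ y, F s y * w s y + ∑ y, w s y ^ 2 := by
    simp only [mul_sum, ← sum_add_distrib]
    refine sum_congr rfl fun y _ => ?_
    linear_combination (w s y) ^ 2 * hφ s
  rw [this]; ring

/-- Cauchy–Schwarz for the bilinear form of `quadForm`. -/
lemma sq_expect_le_quadForm_mul {φ : S → ℝ} (hφ : ∀ s, φ s ^ 2 = 1) {q : S → ℝ}
    (hq : ∀ s, 0 ≤ q s) (F w : S → Y → ℝ) :
    (𝔼 s, φ s * (q s * ∑ y, F s y * w s y)) ^ 2 ≤ quadForm q F * quadForm q w := by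
  have h1 : ∀ s, |φ s * (q s * ∑ y, F s y * w s y)| ≤
      √(q s * ∑ y, F s y ^ 2) * √(q s * ∑ y, w s y ^ 2) := by
    intro s
    rw [← Real.sqrt_mul (mul_nonneg (hq s) (sum_nonneg fun _ _ => sq_nonneg _))]
    apply Real.abs_le_sqrt
    have := sum_mul_sq_le_sq_mul_sq univ (F s) (w s)
    calc (φ s * (q s * ∑ y, F s y * w s y)) ^ 2
        = q s ^ 2 * (∑ y, F s y * w s y) ^ 2 := by
          linear_combination (q s * ∑ y, F s y * w s y) ^ 2 * hφ s
      _ ≤ q s ^ 2 * ((∑ y, F s y ^ 2) * ∑ y, w s y ^ 2) := by gcongr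
      _ = _ := by ring
  have h2 : |𝔼 s, φ s * (q s * ∑ y, F s y * w s y)| ≤
      𝔼 s, √(q s * ∑ y, F s y ^ 2) * √(q s * ∑ y, w s y ^ 2) :=
    (abs_expect_le _ _).trans (expect_le_expect fun s _ => h1 s)
  rw [← sq_abs]
  refine (pow_le_pow_left₀ (abs_nonneg _) h2 2).trans ((expect_mul_sq_le_sq_mul_sq _ _ _).trans ?_)
  apply le_of_eq
  congr 1 <;> refine expect_congr rfl fun s _ => ?_ <;>
    exact Real.sq_sqrt (mul_nonneg (hq s) (sum_nonneg fun _ _ => sq_nonneg _))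

lemma expect_eq_single_div [DecidableEq S] (s : S) (x : ℝ) :
    𝔼 s', (if s' = s then x else 0) = x / Fintype.card S := by
  rw [Fintype.expect_eq_sum_div_card]; simp

/-- The second moment of an average of orthogonal signs. -/
lemma IsSymmOrthonormal.expect_sq [InvolutiveNeg Θ] [Nonempty Θ] {φ : S → Θ → ℝ}
    (hφ : IsSymmOrthonormal φ) (b : S → ℝ) :
    𝔼 t, (𝔼 s, φ s t * b s) ^ 2 = (𝔼 s, b s ^ 2) / Fintype.card S := by
  classical
  have h1 : ∀ t, (𝔼 s, φ s t * b s) ^ 2 = 𝔼 s, 𝔼 s', (φ s t * φ s' t) * (b s * b s') := by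
    intro t
    rw [sq, expect_mul_expect]
    exact expect_congr rfl fun s _ => expect_congr rfl fun s' _ => by ring
  simp only [h1]
  rw [expect_comm, expect_div]
  refine expect_congr rfl fun s _ => ?_
  rw [expect_comm, ← expect_eq_single_div s]
  refine expect_congr rfl fun s' _ => ?_
  rw [← expect_mul]
  split_ifs with h
  · subst h
    simp [← sq, hφ.sq_eq_one]
  · rw [hφ.orthogonal _ _ (Ne.symm h), zero_mul]

/-- Negating `t` preserves the uniform law and flips the exponent, so the odd part averages out. -/
lemma IsSymmOrthonormal.expect_exp [InvolutiveNeg Θ] {φ : S → Θ → ℝ}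
    (hφ : IsSymmOrthonormal φ) (b : S → ℝ) (r : ℝ) :
    𝔼 t, Real.exp (r * 𝔼 s, φ s t * b s) = 𝔼 t, Real.cosh (r * 𝔼 s, φ s t * b s) := by
  have h : 𝔼 t, Real.exp (r * 𝔼 s, φ s t * b s) = 𝔼 t, Real.exp (-(r * 𝔼 s, φ s t * b s)) := by
    refine Fintype.expect_equiv (Equiv.neg Θ) _ _ fun t => ?_
    simp [hφ.map_neg, expect_neg_distrib]
  simp only [Real.cosh_eq]
  rw [← expect_div, expect_add_distrib, ← h]
  ring

/-- From `cosh z - 1 = 2 sinh²(z/2)` and `sinh y ≤ y cosh y`. Keeping the exact `z²` lets the second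
moment of an orthogonal sum enter later. -/
lemma cosh_le_one_add {z u : ℝ} (hz : |z| ≤ u) : Real.cosh z ≤ 1 + z ^ 2 / 2 * Real.exp u := by
  have h1 : Real.cosh z ≤ 1 + z ^ 2 / 2 * Real.cosh z := by
    have h := Real.cosh_sq (z / 2)
    have h2 := Real.cosh_two_mul (z / 2)
    rw [mul_div_cancel₀ _ two_ne_zero] at h2
    have h3 : Real.sinh (z / 2) ^ 2 ≤ (z / 2) ^ 2 * Real.cosh (z / 2) ^ 2 := by
      have key : ∀ y : ℝ, 0 ≤ y → Real.sinh y ≤ y * Real.cosh y := by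
        intro y hy
        have hm : MonotoneOn (fun y : ℝ => y * Real.cosh y - Real.sinh y) (Set.Ici 0) := by
          refine monotoneOn_of_deriv_nonneg (convex_Ici 0) (by fun_prop) (by fun_prop) ?_
          intro x hx
          rw [interior_Ici] at hx
          have : HasDerivAt (fun y : ℝ => y * Real.cosh y - Real.sinh y)
              (1 * Real.cosh x + x * Real.sinh x - Real.cosh x) x :=
            ((hasDerivAt_id x).mul (Real.hasDerivAt_cosh x)).sub (Real.hasDerivAt_sinh x)
          rw [this.deriv]
          have := mul_nonneg (le_of_lt hx) (Real.sinh_nonneg_iff.2 (le_of_lt hx))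
          linarith
        have := hm (Set.mem_Ici.2 le_rfl) (Set.mem_Ici.2 hy) hy
        simp at this
        linarith
      have h4 : |Real.sinh (z / 2)| ≤ |z / 2| * Real.cosh (z / 2) := by
        rw [Real.abs_sinh, ← Real.cosh_abs (z / 2)]
        exact key _ (abs_nonneg _)
      rw [← sq_abs, ← sq_abs (z / 2), ← mul_pow]
      exact pow_le_pow_left₀ (abs_nonneg _) h4 2
    have h5 : Real.cosh (z / 2) ^ 2 ≤ Real.cosh z := by
      have := sq_nonneg (Real.sinh (z / 2)); linarith
    nlinarith [mul_le_mul_of_nonneg_left h5 (sq_nonneg z)]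
  have h2 : Real.cosh z ≤ Real.exp u := by
    rw [← Real.cosh_abs, Real.cosh_eq]
    have h3 := Real.exp_le_exp.2 hz
    have h4 : Real.exp (-|z|) ≤ Real.exp |z| := Real.exp_le_exp.2 (by linarith [abs_nonneg z])
    linarith
  nlinarith [sq_nonneg z]

/-- One step of the potential argument: adding a random signed vector to `F` is paid for by
increasing the weights of the quadratic form. -/
lemma IsSymmOrthonormal.expect_potential_le [InvolutiveNeg Θ] [Nonempty Θ] {φ : S → Θ → ℝ}
    (hφ : IsSymmOrthonormal φ) {p K u : ℝ} (hp : 1 ≤ p) (hK : 0 < K) {q : S → ℝ}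
    (hq : ∀ s, 0 ≤ q s) (hq2 : ∀ s, q s ≤ 2) (F w : S → Y → ℝ) (hu : 0 ≤ u)
    (hw : 4 * p ^ 2 * quadForm q w ≤ u ^ 2 * K) :
    𝔼 t, (K + quadForm q (fun s y => F s y + φ s t * w s y)) ^ p ≤
      Real.exp (p * quadForm q w / K) *
        (K + quadForm (fun s => q s + 8 * p * Real.exp u / (K * Fintype.card S) *
          ∑ y, w s y ^ 2) F) ^ p := by
  set x := quadForm q w with hx
  set G := K + quadForm q F with hG
  have hx0 : 0 ≤ x := quadForm_nonneg hq w
  have hF0 : 0 ≤ quadForm q F := quadForm_nonneg hq F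
  have hGK : K ≤ G := by linarith
  have hG0 : 0 < G := by linarith
  have hp0 : 0 < p := by linarith
  set b : S → ℝ := fun s => q s * ∑ y, F s y * w s y with hb
  set Z : Θ → ℝ := fun t => 𝔼 s, φ s t * b s with hZ
  -- This pointwise bound, with `K ≤ G` and `hw`, keeps the exponent `2pZ/G` within `[-u, u]`.
  have hcs : ∀ t, Z t ^ 2 ≤ G * x := fun t =>
    (sq_expect_le_quadForm_mul (fun s => hφ.sq_eq_one s t) hq F w).trans
      (mul_le_mul_of_nonneg_right (by linarith) hx0)
  have hstep : ∀ t, (K + quadForm q (fun s y => F s y + φ s t * w s y)) ^ p ≤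
      G ^ p * (Real.exp (p * x / K) * Real.exp (2 * p / G * Z t)) := by
    intro t
    have h0 : 0 ≤ K + quadForm q (fun s y => F s y + φ s t * w s y) :=
      add_nonneg hK.le (quadForm_nonneg hq _)
    have h1 : K + quadForm q (fun s y => F s y + φ s t * w s y) =
        G * ((2 * Z t + x) / G + 1) := by
      rw [quadForm_add_signed (fun s => hφ.sq_eq_one s t)]
      change K + (quadForm q F + 2 * Z t + x) = _
      rw [mul_add, mul_div_cancel₀ _ hG0.ne', hG]
      ring
    have h2 : (K + quadForm q (fun s y => F s y + φ s t * w s y)) ≤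
        G * Real.exp ((2 * Z t + x) / G) := by
      rw [h1]; gcongr; exact Real.add_one_le_exp _
    refine (Real.rpow_le_rpow h0 h2 hp0.le).trans ?_
    rw [Real.mul_rpow hG0.le (Real.exp_pos _).le, ← Real.exp_mul, ← Real.exp_add]
    gcongr
    have h3 : p * x / G ≤ p * x / K := by gcongr
    calc (2 * Z t + x) / G * p = p * x / G + 2 * p / G * Z t := by ring
      _ ≤ _ := by linarith
  have hcosh : ∀ t, Real.cosh (2 * p / G * Z t) ≤
      1 + 2 * p ^ 2 * Real.exp u / G ^ 2 * Z t ^ 2 := by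
    intro t
    have hz : |2 * p / G * Z t| ≤ u := by
      apply abs_le_of_sq_le_sq _ hu
      calc (2 * p / G * Z t) ^ 2 = 4 * p ^ 2 / G ^ 2 * Z t ^ 2 := by
            ring_nf
        _ ≤ 4 * p ^ 2 / G ^ 2 * (G * x) := by gcongr; exact hcs t
        _ = 4 * p ^ 2 * x / G := by field_simp
        _ ≤ u ^ 2 * K / G := by gcongr
        _ ≤ u ^ 2 := by
          rw [div_le_iff₀ hG0]; gcongr
    refine (cosh_le_one_add hz).trans (le_of_eq ?_)
    ring_nf
  -- Orthogonality yields the factor `1/|S|`; the 4 is the square of the weight cap 2.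
  have hZ2 : 𝔼 t, Z t ^ 2 ≤ 4 / Fintype.card S *
      quadForm (fun s => ∑ y, w s y ^ 2) F := by
    rw [hZ, hφ.expect_sq, quadForm, div_mul_eq_mul_div, mul_expect]
    gcongr with s
    have := sum_mul_sq_le_sq_mul_sq univ (F s) (w s)
    calc b s ^ 2 = q s ^ 2 * (∑ y, F s y * w s y) ^ 2 := mul_pow _ _ 2
      _ ≤ 2 ^ 2 * ((∑ y, F s y ^ 2) * ∑ y, w s y ^ 2) := by
        gcongr
        · exact hq s
        · exact hq2 s
      _ = _ := by ring
  have hE : 𝔼 t, Real.exp (2 * p / G * Z t) ≤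
      1 + p * (2 * p * Real.exp u / G ^ 2 * 𝔼 t, Z t ^ 2) := by
    rw [hZ, hφ.expect_exp]
    refine (expect_le_expect fun t _ => hcosh t).trans (le_of_eq ?_)
    rw [expect_add_distrib, Fintype.expect_const, ← mul_expect, ← mul_assoc]
    congr 2
    ring
  have hEnn : 0 ≤ 𝔼 t, Z t ^ 2 := expect_nonneg fun t _ => sq_nonneg _
  have hd : 0 ≤ 2 * p * Real.exp u / G ^ 2 * 𝔼 t, Z t ^ 2 := by positivity
  -- Bernoulli moves the gain inside the `p`-th power, where it can be read as an increase of the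
  -- weights.
  have hbern : 1 + p * (2 * p * Real.exp u / G ^ 2 * 𝔼 t, Z t ^ 2) ≤
      (1 + 2 * p * Real.exp u / G ^ 2 * 𝔼 t, Z t ^ 2) ^ p :=
    one_add_mul_self_le_rpow_one_add (by linarith) hp
  have hweights : G + 2 * p * Real.exp u / G * 𝔼 t, Z t ^ 2 ≤
      K + quadForm (fun s => q s + 8 * p * Real.exp u / (K * Fintype.card S) *
        ∑ y, w s y ^ 2) F := by
    have hadd : quadForm (fun s => q s + 8 * p * Real.exp u / (K * Fintype.card S) *
        ∑ y, w s y ^ 2) F = quadForm q F + 8 * p * Real.exp u / (K * Fintype.card S) *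
        quadForm (fun s => ∑ y, w s y ^ 2) F := by
      simp only [quadForm, add_mul, expect_add_distrib, mul_expect, mul_assoc]
    rw [hadd, ← add_assoc]
    refine add_le_add_right ?_ _
    calc 2 * p * Real.exp u / G * 𝔼 t, Z t ^ 2
        ≤ 2 * p * Real.exp u / K * (4 / Fintype.card S *
          quadForm (fun s => ∑ y, w s y ^ 2) F) := by gcongr
      _ = _ := by rw [mul_comm K, ← div_div]; ring
  calc 𝔼 t, (K + quadForm q (fun s y => F s y + φ s t * w s y)) ^ p
      ≤ 𝔼 t, G ^ p * (Real.exp (p * x / K) * Real.exp (2 * p / G * Z t)) :=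
        expect_le_expect fun t _ => hstep t
    _ = Real.exp (p * x / K) * (G ^ p * 𝔼 t, Real.exp (2 * p / G * Z t)) := by
        rw [← mul_expect, ← mul_expect]; ring
    _ ≤ Real.exp (p * x / K) * (G ^ p * (1 + 2 * p * Real.exp u / G ^ 2 * 𝔼 t, Z t ^ 2) ^ p) := by
        gcongr; exact hE.trans hbern
    _ = Real.exp (p * x / K) * (G + 2 * p * Real.exp u / G * 𝔼 t, Z t ^ 2) ^ p := by
        rw [← Real.mul_rpow hG0.le (by positivity)]
        congr 2
        field_simp
    _ ≤ _ := by gcongr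

end OneStep

/-! ### Moments of a sum of independent randomly signed vectors -/

section ManySteps

variable {S Y Θ σ : Type*} [Fintype S] [Fintype Y] [Fintype Θ] [Fintype σ]

/-- Resampling one coordinate: exchanging `θ α` with `t` is an involution of the product. -/
lemma expect_update [DecidableEq σ] [Nonempty Θ] (α : σ) (f : (σ → Θ) → ℝ) :
    𝔼 θ, f θ = 𝔼 θ, 𝔼 t, f (update θ α t) := by
  have hinv : Involutive fun x : (σ → Θ) × Θ => (update x.1 α x.2, x.1 α) := by
    rintro ⟨θ, t⟩; simp
  calc 𝔼 θ, f θ = 𝔼 θ : σ → Θ, 𝔼 _t : Θ, f θ := by simp only [Fintype.expect_const]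
    _ = 𝔼 x : (σ → Θ) × Θ, f x.1 := by rw [← univ_product_univ, expect_product]
    _ = 𝔼 x : (σ → Θ) × Θ, f (update x.1 α x.2) :=
        (Fintype.expect_equiv hinv.toPerm _ _ fun x => rfl).symm
    _ = _ := by rw [← univ_product_univ, expect_product]

/-- Each vector is averaged out with the others frozen, and its cost passes into the weights. The
cap 2 on the final weights holds at every stage; it turns the constant 4 of the single step into 8
for unit weights. -/
lemma IsSymmOrthonormal.expect_potential_sum_le [InvolutiveNeg Θ] [Nonempty Θ] [DecidableEq σ]
    {φ : S → Θ → ℝ} (hφ : IsSymmOrthonormal φ) {p K u : ℝ} (hp : 1 ≤ p) (hK : 0 < K) (hu : 0 ≤ u)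
    (w : σ → S → Y → ℝ) (F₀ : (σ → Θ) → S → Y → ℝ) (T : Finset σ)
    (hw : ∀ α ∈ T, 8 * p ^ 2 * quadForm (fun _ => 1) (w α) ≤ u ^ 2 * K)
    (hF₀ : ∀ α ∈ T, ∀ θ t, F₀ (update θ α t) = F₀ θ) (q : S → ℝ) (hq : ∀ s, 0 ≤ q s)
    (hq2 : ∀ s, q s + 8 * p * Real.exp u / (K * Fintype.card S) * ∑ α ∈ T, ∑ y, w α s y ^ 2 ≤ 2) :
    𝔼 θ : σ → Θ, (K + quadForm q (fun s y => F₀ θ s y + ∑ α ∈ T, φ s (θ α) * w α s y)) ^ p ≤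
      Real.exp (2 * p / K * ∑ α ∈ T, quadForm (fun _ => 1) (w α)) *
        𝔼 θ, (K + quadForm (fun s => q s + 8 * p * Real.exp u / (K * Fintype.card S) *
          ∑ α ∈ T, ∑ y, w α s y ^ 2) (F₀ θ)) ^ p := by
  induction T using Finset.induction_on generalizing q with
  | empty => simp
  | insert α T hα ih =>
    have hp0 : 0 < p := by linarith
    set δ := 8 * p * Real.exp u / (K * Fintype.card S) with hδ
    have hδ0 : 0 ≤ δ := by positivity
    have hle2 : ∀ s, q s ≤ 2 := fun s => le_trans (le_add_of_nonneg_right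
      (mul_nonneg hδ0 (sum_nonneg fun _ _ => sum_nonneg fun _ _ => sq_nonneg _))) (hq2 s)
    have hx : quadForm q (w α) ≤ 2 * quadForm (fun _ => 1) (w α) :=
      (quadForm_mono hle2 _).trans_eq (quadForm_const 2 _)
    have hq' : ∀ s, 0 ≤ q s + δ * ∑ y, w α s y ^ 2 := fun s =>
      add_nonneg (hq s) (mul_nonneg hδ0 (sum_nonneg fun _ _ => sq_nonneg _))
    have hsplit : ∀ s, q s + δ * ∑ y, w α s y ^ 2 + δ * ∑ β ∈ T, ∑ y, w β s y ^ 2 =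
        q s + δ * ∑ β ∈ insert α T, ∑ y, w β s y ^ 2 := by
      intro s; rw [sum_insert hα]; ring
    have ih' := ih (fun β hβ => hw β (mem_insert_of_mem hβ))
      (fun β hβ => hF₀ β (mem_insert_of_mem hβ)) (fun s => q s + δ * ∑ y, w α s y ^ 2) hq'
      (fun s => (hsplit s).trans_le (hq2 s))
    simp only [hsplit] at ih'
    have hstep : ∀ θ : σ → Θ, 𝔼 t, (K + quadForm q (fun s y => F₀ (update θ α t) s y +
        ∑ β ∈ insert α T, φ s (update θ α t β) * w β s y)) ^ p ≤
        Real.exp (2 * p / K * quadForm (fun _ => 1) (w α)) *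
          (K + quadForm (fun s => q s + δ * ∑ y, w α s y ^ 2)
            (fun s y => F₀ θ s y + ∑ β ∈ T, φ s (θ β) * w β s y)) ^ p := by
      intro θ
      have hrw : ∀ t, (fun s y => F₀ (update θ α t) s y +
          ∑ β ∈ insert α T, φ s (update θ α t β) * w β s y) =
          fun s y => (F₀ θ s y + ∑ β ∈ T, φ s (θ β) * w β s y) + φ s t * w α s y := by
        intro t
        ext s y
        have : ∑ β ∈ T, φ s (update θ α t β) * w β s y = ∑ β ∈ T, φ s (θ β) * w β s y :=
          sum_congr rfl fun β hβ => by rw [update_of_ne (ne_of_mem_of_not_mem hβ hα)]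
        rw [hF₀ α (mem_insert_self _ _), sum_insert hα, this, update_self]
        ring
      simp only [hrw]
      refine (hφ.expect_potential_le hp hK hq hle2 _ (w α) hu ?_).trans ?_
      · calc 4 * p ^ 2 * quadForm q (w α) ≤ 4 * p ^ 2 * (2 * quadForm (fun _ => 1) (w α)) := by
              gcongr
          _ = 8 * p ^ 2 * quadForm (fun _ => 1) (w α) := by ring
          _ ≤ _ := hw α (mem_insert_self _ _)
      · refine mul_le_mul_of_nonneg_right (Real.exp_le_exp.2 ?_)
          (Real.rpow_nonneg (add_nonneg hK.le (quadForm_nonneg hq' _)) _)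
        calc p * quadForm q (w α) / K ≤ p * (2 * quadForm (fun _ => 1) (w α)) / K := by gcongr
          _ = _ := by ring
    rw [expect_update α]
    refine (expect_le_expect fun θ _ => hstep θ).trans ?_
    rw [← mul_expect, sum_insert hα, mul_add, Real.exp_add, mul_assoc]
    exact mul_le_mul_of_nonneg_left ih' (Real.exp_pos _).le

/-- Cauchy–Schwarz over `T`, valid for every choice of signs; it serves for the few large vectors.
-/
lemma quadForm_one_sum_le {ι : Type*} {ψ : S → ι → ℝ} (hψ : ∀ s α, ψ s α ^ 2 = 1)
    (w : ι → S → Y → ℝ) (T : Finset ι) :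
    quadForm (fun _ => 1) (fun s y => ∑ α ∈ T, ψ s α * w α s y) ≤
      T.card * ∑ α ∈ T, quadForm (fun _ => 1) (w α) := by
  simp only [quadForm, one_mul]
  rw [← expect_sum_comm, mul_expect]
  refine expect_le_expect fun s _ => ?_
  rw [sum_comm, mul_sum]
  refine sum_le_sum fun y _ => ?_
  refine sq_sum_le_card_mul_sum_sq.trans (le_of_eq ?_)
  simp only [mul_pow, hψ, one_mul]

/-- The moments of the squared norm of a sum of independent randomly signed vectors, in terms of
the sum `B` of the squared norms and a uniform bound `A` on the spectrum. -/
theorem IsSymmOrthonormal.expect_quadForm_rpow_le [DecidableEq σ] [InvolutiveNeg Θ]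
    [Nonempty Θ] [Nonempty S]
    {φ : S → Θ → ℝ} (hφ : IsSymmOrthonormal φ) {p u A : ℝ} (hp : 1 ≤ p) (hu : 0 < u) (hup : u ≤ p)
    (w : σ → S → Y → ℝ) (hA : ∀ s, ∑ α, ∑ y, w α s y ^ 2 ≤ A) :
    𝔼 θ : σ → Θ, (quadForm (fun _ => 1) (fun s y => ∑ α, φ s (θ α) * w α s y)) ^ p ≤
      (16 * p * ((∑ α, quadForm (fun _ => 1) (w α)) / u +
        Real.exp u * A / Fintype.card S)) ^ p := by
  classical
  have hp0 : 0 < p := by linarith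
  set B := ∑ α, quadForm (fun _ => 1) (w α) with hB
  set m : ℝ := (Fintype.card S : ℝ) with hm
  have hm0 : 0 < m := by rw [hm]; exact_mod_cast Fintype.card_pos
  have hN : ∀ α, 0 ≤ quadForm (fun _ => 1) (w α) := fun α =>
    quadForm_nonneg (fun _ => zero_le_one) _
  have hB0 : 0 ≤ B := sum_nonneg fun α _ => hN α
  have hA0 : 0 ≤ A := by
    obtain ⟨s⟩ := ‹Nonempty S›
    exact (sum_nonneg fun _ _ => sum_nonneg fun _ _ => sq_nonneg _).trans (hA s)
  rcases hB0.eq_or_lt with hBz | hBpos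
  -- If `B = 0`, then `K` below may vanish, but so does the whole sum.
  · have h0 : ∀ θ : σ → Θ,
        quadForm (fun _ => 1) (fun s y => ∑ α, φ s (θ α) * w α s y) = 0 := by
      intro θ
      refine le_antisymm ?_ (quadForm_nonneg (fun _ => zero_le_one) _)
      have := quadForm_one_sum_le (ψ := fun s α => φ s (θ α)) (fun s α => hφ.sq_eq_one s _) w univ
      rwa [← hB, ← hBz, mul_zero] at this
    simp only [h0, Real.zero_rpow hp0.ne', expect_const_zero]
    exact Real.rpow_nonneg (by positivity) _
  -- The first summand gives `8pB ≤ uK`; the second keeps the total weight increase below 1.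
  set K := 8 * p * (B / u + Real.exp u * A / m) with hK
  have hK0 : 0 < K := by positivity
  have hBK : 8 * p * B ≤ u * K := by
    have : u * K = 8 * p * B + 8 * p * u * (Real.exp u * A / m) := by
      rw [hK]; field_simp
    rw [this]
    exact le_add_of_nonneg_right (by positivity)
  have hAK : 8 * p * Real.exp u / (K * m) * A ≤ 1 := by
    rw [div_mul_eq_mul_div, div_le_one (by positivity)]
    have : K * m = 8 * p * B / u * m + 8 * p * Real.exp u * A := by
      rw [hK]; field_simp
    rw [this]
    exact le_add_of_nonneg_left (by positivity)
  -- `T` holds the vectors small enough for the potential argument. At most `8p²B/(u²K)` others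
  -- remain, so Cauchy–Schwarz bounds their sum by `K/8`.
  set T := univ.filter fun α => 8 * p ^ 2 * quadForm (fun _ => 1) (w α) ≤ u ^ 2 * K with hT
  have hlarge : (Tᶜ.card : ℝ) * (u ^ 2 * K) ≤ 8 * p ^ 2 * B := by
    rw [← nsmul_eq_mul]
    refine (card_nsmul_le_sum Tᶜ (fun α => 8 * p ^ 2 * quadForm (fun _ => 1) (w α)) _ ?_).trans ?_
    · intro α hα
      simp only [hT, mem_compl, mem_filter, mem_univ, true_and, not_le] at hα
      exact hα.le
    · rw [← mul_sum]
      gcongr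
      exact sum_le_sum_of_subset_of_nonneg (subset_univ _) fun α _ _ => hN α
  set F₀ : (σ → Θ) → S → Y → ℝ := fun θ s y => ∑ α ∈ Tᶜ, φ s (θ α) * w α s y with hF₀
  have hF₀K : ∀ θ, quadForm (fun _ => 1) (F₀ θ) ≤ K / 8 := by
    intro θ
    have h1 : quadForm (fun _ => 1) (F₀ θ) ≤ Tᶜ.card * B := by
      refine (quadForm_one_sum_le (ψ := fun s α => φ s (θ α))
        (fun s α => hφ.sq_eq_one s _) w Tᶜ).trans ?_
      gcongr
      exact sum_le_sum_of_subset_of_nonneg (subset_univ _) fun α _ _ => hN α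
    refine h1.trans ?_
    have h2 : (Tᶜ.card * B) * (u ^ 2 * K) ≤ K / 8 * (u ^ 2 * K) := by
      calc (Tᶜ.card * B) * (u ^ 2 * K) = (Tᶜ.card * (u ^ 2 * K)) * B := by ring
        _ ≤ 8 * p ^ 2 * B * B := by gcongr
        _ = (8 * p * B) ^ 2 / 8 := by ring
        _ ≤ (u * K) ^ 2 / 8 := by gcongr
        _ = _ := by ring
    exact le_of_mul_le_mul_right h2 (by positivity)
  have hweights : ∀ s, 1 + 8 * p * Real.exp u / (K * m) * ∑ α ∈ T, ∑ y, w α s y ^ 2 ≤ 2 := by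
    intro s
    have h1 : ∑ α ∈ T, ∑ y, w α s y ^ 2 ≤ A :=
      (sum_le_sum_of_subset_of_nonneg (subset_univ _) fun α _ _ =>
        sum_nonneg fun _ _ => sq_nonneg _).trans (hA s)
    have h2 : 8 * p * Real.exp u / (K * m) * ∑ α ∈ T, ∑ y, w α s y ^ 2 ≤
        8 * p * Real.exp u / (K * m) * A := by gcongr
    linarith
  have hmain := hφ.expect_potential_sum_le hp hK0 hu.le w F₀ T
    (fun α hα => (mem_filter.1 hα).2)
    (fun α hα θ t => by
      ext s y
      refine sum_congr rfl fun β hβ => ?_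
      rw [update_of_ne (ne_of_mem_of_not_mem hα (mem_compl.1 hβ)).symm])
    (fun _ => 1) (fun _ => zero_le_one) hweights
  have hexp : Real.exp (2 * p / K * ∑ α ∈ T, quadForm (fun _ => 1) (w α)) ≤
      Real.exp (1 / 4) ^ p := by
    rw [← Real.exp_mul]
    apply Real.exp_le_exp.2
    calc 2 * p / K * ∑ α ∈ T, quadForm (fun _ => 1) (w α) ≤ 2 * p / K * B := by
          gcongr
          exact sum_le_sum_of_subset_of_nonneg (subset_univ _) fun α _ _ => hN α
      _ = 8 * p * B / (4 * K) := by field_simp; ring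
      _ ≤ u * K / (4 * K) := by gcongr
      _ = u / 4 := by field_simp
      _ ≤ 1 / 4 * p := by linarith
  have hF₀exp : 𝔼 θ, (K + quadForm (fun s => 1 + 8 * p * Real.exp u / (K * m) *
      ∑ α ∈ T, ∑ y, w α s y ^ 2) (F₀ θ)) ^ p ≤ (5 / 4 * K) ^ p := by
    refine expect_le univ_nonempty fun θ _ => ?_
    have h1 := (quadForm_mono hweights (F₀ θ)).trans_eq (quadForm_const 2 _)
    refine Real.rpow_le_rpow (add_nonneg hK0.le (quadForm_nonneg (fun s => ?_) _)) ?_ hp0.le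
    · have : 0 ≤ ∑ α ∈ T, ∑ y, w α s y ^ 2 :=
        sum_nonneg fun _ _ => sum_nonneg fun _ _ => sq_nonneg _
      positivity
    · linarith [hF₀K θ]
  have hsum : ∀ θ : σ → Θ, quadForm (fun _ => 1) (fun s y => ∑ α, φ s (θ α) * w α s y) ≤
      K + quadForm (fun _ => 1) (fun s y => F₀ θ s y + ∑ α ∈ T, φ s (θ α) * w α s y) := by
    intro θ
    simp only [hF₀, sum_compl_add_sum]
    linarith
  calc 𝔼 θ : σ → Θ, (quadForm (fun _ => 1) (fun s y => ∑ α, φ s (θ α) * w α s y)) ^ p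
      ≤ 𝔼 θ : σ → Θ, (K + quadForm (fun _ => 1)
          (fun s y => F₀ θ s y + ∑ α ∈ T, φ s (θ α) * w α s y)) ^ p :=
        expect_le_expect fun θ _ => Real.rpow_le_rpow
          (quadForm_nonneg (fun _ => zero_le_one) _) (hsum θ) hp0.le
    _ ≤ Real.exp (1 / 4) ^ p * (5 / 4 * K) ^ p :=
        hmain.trans (mul_le_mul hexp hF₀exp (expect_nonneg fun θ _ => Real.rpow_nonneg
          (add_nonneg hK0.le (quadForm_nonneg (fun s => by
            have : 0 ≤ ∑ α ∈ T, ∑ y, w α s y ^ 2 :=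
              sum_nonneg fun _ _ => sum_nonneg fun _ _ => sq_nonneg _
            positivity) _)) _) (by positivity))
    _ = (Real.exp (1 / 4) * (5 / 4 * K)) ^ p := (Real.mul_rpow (Real.exp_pos _).le
        (by positivity)).symm
    _ ≤ (16 * p * (B / u + Real.exp u * A / m)) ^ p := by
        refine Real.rpow_le_rpow (by positivity) ?_ hp0.le
        -- With `e^(1/4) ≤ 8/5` the total is at most `(8/5)(5/4)K = 2K`.
        have h1 : Real.exp (1 / 4) ≤ 8 / 5 := by
          have h2 : Real.exp (1 / 4) ^ 4 = Real.exp 1 := by rw [← Real.exp_nat_mul]; norm_num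
          refine le_of_pow_le_pow_left₀ (n := 4) (by norm_num) (by norm_num) ?_
          rw [h2]
          exact Real.exp_one_lt_d9.le.trans (by norm_num)
        calc Real.exp (1 / 4) * (5 / 4 * K) ≤ 8 / 5 * (5 / 4 * K) := by gcongr
          _ = _ := by rw [hK]; ring

end ManySteps

/-! ### Decoupled chaos, by induction on the number of characters -/

section Tables

variable {S Θ σ : Type*} [Fintype S] [Fintype Θ] [Fintype σ]

lemma expect_fin_cons (X : Type*) [Fintype X] {n : ℕ} (f : (Fin (n + 1) → X) → ℝ) :
    𝔼 x, f x = 𝔼 x₀ : X, 𝔼 x : Fin n → X, f (Fin.cons x₀ x) := by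
  rw [← expect_product', univ_product_univ]
  exact (Fintype.expect_equiv (Fin.consEquiv fun _ => X) _ _ fun x => rfl).symm

lemma sum_fin_cons (X : Type*) [Fintype X] {n : ℕ} (f : (Fin (n + 1) → X) → ℝ) :
    ∑ x, f x = ∑ x₀ : X, ∑ x : Fin n → X, f (Fin.cons x₀ x) := by
  rw [← Fintype.sum_prod_type']
  exact (Fintype.sum_equiv (Fin.consEquiv fun _ => X) _ _ fun x => rfl).symm

lemma add_rpow_le_two_mul {p x y : ℝ} (hp : 0 ≤ p) (hx : 0 ≤ x) (hy : 0 ≤ y) :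
    (x + y) ^ p ≤ (2 * x) ^ p + (2 * y) ^ p := by
  rcases le_total x y with h | h
  · exact (Real.rpow_le_rpow (by positivity) (by linarith) hp).trans
      (le_add_of_nonneg_left (by positivity))
  · exact (Real.rpow_le_rpow (by positivity) (by linarith) hp).trans
      (le_add_of_nonneg_right (by positivity))

lemma IsSymmOrthonormal.single {S : Type*} [InvolutiveNeg Θ] {φ : S → Θ → ℝ} (hφ : IsSymmOrthonormal φ)
    (s : S) : IsSymmOrthonormal fun _ : Unit => φ s :=
  ⟨fun _ t => hφ.map_neg s t, fun _ t => hφ.sq_eq_one s t, fun _ _ h => absurd rfl h⟩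

/-- A Khintchine inequality for vector-valued sums. -/
lemma IsSymmOrthonormal.expect_sum_sq_rpow_le {S Y : Type*} [Fintype Y] [DecidableEq σ]
    [InvolutiveNeg Θ] [Nonempty Θ] {φ : S → Θ → ℝ} (hφ : IsSymmOrthonormal φ) {p A : ℝ} (hp : 1 ≤ p)
    (s : S) (w : σ → Y → ℝ) (hA : ∑ α, ∑ y, w α y ^ 2 ≤ A) :
    𝔼 θ : σ → Θ, (∑ y, (∑ α, φ s (θ α) * w α y) ^ 2) ^ p ≤ (60 * p * A) ^ p := by
  -- A single index makes orthogonality vacuous; `u = 1` gives `16(1 + e) ≤ 60`.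
  have h := (hφ.single s).expect_quadForm_rpow_le hp one_pos hp (fun α _ => w α) (fun _ => hA)
  simp only [quadForm, univ_unique, expect_singleton, one_mul, Fintype.card_unit, Nat.cast_one,
    div_one] at h
  have hA0 : 0 ≤ ∑ α, ∑ y, w α y ^ 2 := sum_nonneg fun _ _ => sum_nonneg fun _ _ => sq_nonneg _
  have hA1 : 0 ≤ A := hA0.trans hA
  have hp0 : 0 < p := by linarith
  refine h.trans (Real.rpow_le_rpow (by positivity) ?_ hp0.le)
  have := Real.exp_one_lt_d9
  calc 16 * p * (∑ α, ∑ y, w α y ^ 2 + Real.exp 1 * A) ≤ 16 * p * (A + 2.75 * A) := by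
        gcongr; linarith
    _ = _ := by ring

/-- Moments of the squared norm of a decoupled chaos whose coefficients are orthogonal signs. -/
theorem IsSymmOrthonormal.expect_chaos_rpow_le [DecidableEq σ] [InvolutiveNeg Θ] [Nonempty Θ]
    [Nonempty S] {φ : S → Θ → ℝ} (hφ : IsSymmOrthonormal φ) {p u : ℝ} (hp : 1 ≤ p) (hu : 1 ≤ u)
    (hup : u ≤ p) (hS : (Fintype.card S : ℝ) ≤ Real.exp p) (c : ℕ)
    (a : S → (Fin c → σ) → ℝ) {A : ℝ} (hA : ∀ s, ∑ x, a s x ^ 2 ≤ A) :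
    𝔼 θ : Fin c → σ → Θ, (𝔼 s, (∑ x, (∏ i, φ s (θ i (x i))) * a s x) ^ 2) ^ p ≤
      ((400 * p) ^ c * ((𝔼 s, ∑ x, a s x ^ 2) / u ^ c +
        c * (Real.exp u * A / Fintype.card S))) ^ p := by
  have hp0 : 0 < p := by linarith
  have hu0 : 0 < u := by linarith
  induction c generalizing A with
  | zero => simp
  | succ c ih =>
    set m : ℝ := (Fintype.card S : ℝ) with hm
    have hm0 : 0 < m := by rw [hm]; exact_mod_cast Fintype.card_pos
    have hA0 : 0 ≤ A := by
      obtain ⟨s⟩ := ‹Nonempty S›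
      exact (sum_nonneg fun _ _ => sq_nonneg _).trans (hA s)
    set B := 𝔼 s, ∑ x, a s x ^ 2 with hB
    have hB0 : 0 ≤ B := expect_nonneg fun _ _ => sum_nonneg fun _ _ => sq_nonneg _
    set w : σ → S → (Fin c → σ) → ℝ := fun α s x => a s (Fin.cons α x) with hw
    have hwA : ∀ s, ∑ α, ∑ x, w α s x ^ 2 = ∑ x, a s x ^ 2 := fun s =>
      (sum_fin_cons σ fun x => a s x ^ 2).symm
    have hwB : ∑ α, quadForm (fun _ => 1) (w α) = B := by
      simp only [quadForm, one_mul]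
      rw [← expect_sum_comm]
      exact expect_congr rfl fun s _ => hwA s
    set a' : (σ → Θ) → S → (Fin c → σ) → ℝ := fun θ s x => ∑ α, φ s (θ α) * w α s x with ha'
    set X : (σ → Θ) → S → ℝ := fun θ s => ∑ x, a' θ s x ^ 2 with hX
    have hX0 : ∀ θ s, 0 ≤ X θ s := fun θ s => sum_nonneg fun _ _ => sq_nonneg _
    have hB' : 𝔼 θ, (𝔼 s, X θ s) ^ p ≤ (16 * p * (B / u + Real.exp u * A / m)) ^ p := by
      have h := hφ.expect_quadForm_rpow_le hp hu0 hup w (fun s => (hwA s).trans_le (hA s))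
      rw [hwB] at h
      simpa only [quadForm, one_mul] using h
    -- The `ℓ^p` norm over `s` stands in for the maximum: its `p`-th moment is a sum of `m ≤ e^p`
    -- Khintchine bounds, and `60e ≤ 164`.
    set A' : (σ → Θ) → ℝ := fun θ => (∑ s, X θ s ^ p) ^ p⁻¹ with hA'
    have hA'0 : ∀ θ, 0 ≤ A' θ := fun θ =>
      Real.rpow_nonneg (sum_nonneg fun s _ => Real.rpow_nonneg (hX0 θ s) _) _
    have hXA' : ∀ θ s, X θ s ≤ A' θ := by
      intro θ s
      rw [hA', Real.le_rpow_inv_iff_of_pos (hX0 θ s)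
        (sum_nonneg fun s _ => Real.rpow_nonneg (hX0 θ s) _) hp0]
      exact single_le_sum (f := fun s => X θ s ^ p)
        (fun s _ => Real.rpow_nonneg (hX0 θ s) _) (mem_univ s)
    have hA'p : 𝔼 θ, A' θ ^ p ≤ (164 * p * A) ^ p := by
      have h1 : ∀ θ, A' θ ^ p = ∑ s, X θ s ^ p := fun θ =>
        Real.rpow_inv_rpow (sum_nonneg fun s _ => Real.rpow_nonneg (hX0 θ s) _) hp0.ne'
      simp only [h1]
      rw [expect_sum_comm]
      calc ∑ s, 𝔼 θ, X θ s ^ p ≤ ∑ _s : S, (60 * p * A) ^ p := sum_le_sum fun s _ =>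
            hφ.expect_sum_sq_rpow_le hp s (fun α => w α s) ((hwA s).trans_le (hA s))
        _ = m * (60 * p * A) ^ p := by rw [sum_const, card_univ, nsmul_eq_mul]
        _ ≤ Real.exp 1 ^ p * (60 * p * A) ^ p := by
            gcongr
            rwa [← Real.exp_mul, one_mul]
        _ = (Real.exp 1 * (60 * p * A)) ^ p :=
            (Real.mul_rpow (Real.exp_pos _).le (by positivity)).symm
        _ ≤ _ := by
            refine Real.rpow_le_rpow (by positivity) ?_ hp0.le
            have := Real.exp_one_lt_d9
            have h2 : 0 ≤ 60 * p * A := by positivity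
            nlinarith
    have hsplit : ∀ (θ₀ : σ → Θ) (θ : Fin c → σ → Θ) (s : S),
        ∑ x, (∏ i, φ s ((Fin.cons θ₀ θ : Fin (c + 1) → σ → Θ) i (x i))) * a s x =
          ∑ x, (∏ i, φ s (θ i (x i))) * a' θ₀ s x := by
      intro θ₀ θ s
      rw [sum_fin_cons, sum_comm]
      refine sum_congr rfl fun x _ => ?_
      rw [ha', mul_sum]
      refine sum_congr rfl fun α _ => ?_
      rw [Fin.prod_univ_succ]
      simp only [Fin.cons_zero, Fin.cons_succ, hw]
      ring
    -- Coefficients of the new average and new maximum in the inductive bound; the 2 comes from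
    -- splitting the `p`-th power of a sum.
    set P := 2 * ((400 * p) ^ c / u ^ c) with hP
    set R := 2 * ((400 * p) ^ c * (c * (Real.exp u / m))) with hR
    have hP0 : 0 ≤ P := by positivity
    have hR0 : 0 ≤ R := by positivity
    have hBX : ∀ θ, 0 ≤ 𝔼 s, X θ s := fun θ => expect_nonneg fun s _ => hX0 θ s
    have hcond : ∀ θ₀ : σ → Θ, 𝔼 θ : Fin c → σ → Θ,
        (𝔼 s, (∑ x, (∏ i, φ s (θ i (x i))) * a' θ₀ s x) ^ 2) ^ p ≤
          P ^ p * (𝔼 s, X θ₀ s) ^ p + R ^ p * A' θ₀ ^ p := by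
      intro θ₀
      refine (ih (a' θ₀) (hXA' θ₀)).trans ?_
      rw [← Real.mul_rpow hP0 (hBX θ₀), ← Real.mul_rpow hR0 (hA'0 θ₀)]
      have h := add_rpow_le_two_mul hp0.le
        (x := (400 * p) ^ c / u ^ c * 𝔼 s, X θ₀ s)
        (y := (400 * p) ^ c * (c * (Real.exp u / m)) * A' θ₀)
        (mul_nonneg (by positivity) (hBX θ₀)) (mul_nonneg (by positivity) (hA'0 θ₀))
      refine (le_of_eq ?_).trans (h.trans (le_of_eq ?_))
      · congr 1; ring
      · rw [hP, hR]; congr 2 <;> ring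
    rw [expect_fin_cons]
    simp only [hsplit]
    calc 𝔼 θ₀ : σ → Θ, 𝔼 θ : Fin c → σ → Θ,
          (𝔼 s, (∑ x, (∏ i, φ s (θ i (x i))) * a' θ₀ s x) ^ 2) ^ p
        ≤ 𝔼 θ₀ : σ → Θ, (P ^ p * (𝔼 s, X θ₀ s) ^ p + R ^ p * A' θ₀ ^ p) :=
          expect_le_expect fun θ₀ _ => hcond θ₀
      _ = P ^ p * 𝔼 θ₀, (𝔼 s, X θ₀ s) ^ p + R ^ p * 𝔼 θ₀, A' θ₀ ^ p := by
          rw [expect_add_distrib, mul_expect, mul_expect]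
      _ ≤ P ^ p * (16 * p * (B / u + Real.exp u * A / m)) ^ p + R ^ p * (164 * p * A) ^ p := by
          gcongr
      _ = (P * (16 * p * (B / u + Real.exp u * A / m))) ^ p + (R * (164 * p * A)) ^ p := by
          rw [← Real.mul_rpow hP0 (by positivity), ← Real.mul_rpow hR0 (by positivity)]
      _ ≤ (P * (16 * p * (B / u + Real.exp u * A / m)) + R * (164 * p * A)) ^ p :=
          Real.add_rpow_le_rpow_add (by positivity) (by positivity) hp
      _ ≤ _ := by
          refine Real.rpow_le_rpow (by positivity) ?_ hp0.le
          set D := Real.exp u * A / m with hD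
          have hD0 : 0 ≤ D := by positivity
          have hRD : R * (164 * p * A) = (400 * p) ^ c * p * (328 * (c * D)) := by
            rw [hR, hD]; ring
          have hPD : P * (16 * p * (B / u + D)) =
              (400 * p) ^ c * p * (32 * (B / u ^ (c + 1) + D / u ^ c)) := by
            rw [hP]; field_simp; ring
          have hDu : D / u ^ c ≤ D := div_le_self hD0 (one_le_pow₀ hu)
          have hBu : 0 ≤ B / u ^ (c + 1) := by positivity
          have hcD : 0 ≤ (c : ℝ) * D := by positivity
          rw [hRD, hPD, ← mul_add]
          calc (400 * p) ^ c * p * (32 * (B / u ^ (c + 1) + D / u ^ c) + 328 * (c * D))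
              ≤ (400 * p) ^ c * p * (400 * (B / u ^ (c + 1) + (c * D + D))) := by
                gcongr; linarith
            _ = _ := by push_cast; ring

end Tables

/-! ### Fourier analysis on `(ℤ/2ℤ)^l` -/

section Walsh

/-- The nontrivial character of `ℤ/2ℤ`. -/
def signChar (a : ZMod 2) : ℝ := if a = 0 then 1 else -1

lemma signChar_add (a b : ZMod 2) : signChar (a + b) = signChar a * signChar b := by
  have h : ∀ a b : ZMod 2, (a + b = 0 ↔ a = b) ∧ (a = 0 ∨ a = 1) ∧ (b = 0 ∨ b = 1) := by decide
  obtain ⟨-, rfl | rfl, rfl | rfl⟩ := h a b <;> simp [signChar, (h 1 1).1]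

lemma signChar_sq (a : ZMod 2) : signChar a ^ 2 = 1 := by
  unfold signChar; split_ifs <;> norm_num

lemma sum_signChar_mul (a : ZMod 2) : ∑ b, signChar (a * b) = if a = 0 then 2 else 0 := by
  have h : ∀ a : ZMod 2, a = 0 ∨ a = 1 := by decide
  have h2 : ∀ f : ZMod 2 → ℝ, ∑ b, f b = f 0 + f 1 := fun f => Fin.sum_univ_two f
  rw [h2]
  obtain rfl | rfl := h a <;> norm_num [signChar]

variable {l : ℕ}

/-- The Walsh characters of `(ℤ/2ℤ)^l`. -/
noncomputable def walsh (s j : HashRange l) : ℝ := ∏ i, signChar (s i * j i)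

lemma walsh_comm (s j : HashRange l) : walsh s j = walsh j s :=
  prod_congr rfl fun i _ => by rw [mul_comm]

lemma walsh_add (s j k : HashRange l) : walsh s (j + k) = walsh s j * walsh s k := by
  simp only [walsh, Pi.add_apply, mul_add, signChar_add, prod_mul_distrib]

lemma walsh_zero (s : HashRange l) : walsh s 0 = 1 := by simp [walsh, signChar]

lemma walsh_sq (s j : HashRange l) : walsh s j ^ 2 = 1 := by
  simp only [walsh, ← prod_pow, signChar_sq, prod_const_one]

lemma abs_walsh (s j : HashRange l) : |walsh s j| = 1 := by
  rw [← sq_eq_sq₀ (abs_nonneg _) zero_le_one, sq_abs, walsh_sq, one_pow]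

lemma walsh_sum {ι : Type*} (s : HashRange l) (T : Finset ι) (f : ι → HashRange l) :
    walsh s (∑ i ∈ T, f i) = ∏ i ∈ T, walsh s (f i) := by
  classical
  induction T using Finset.induction_on with
  | empty => simp [walsh_zero]
  | insert i T hi ih => rw [sum_insert hi, prod_insert hi, walsh_add, ih]

lemma add_eq_zero_iff_eq_hashRange (s s' : HashRange l) : s + s' = 0 ↔ s = s' := by
  have h : ∀ a b : ZMod 2, a + b = 0 ↔ a = b := by decide
  simp only [funext_iff, Pi.add_apply, Pi.zero_apply, h]

lemma card_hashRange : (Fintype.card (HashRange l) : ℝ) = 2 ^ l := by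
  simp [ZMod.card]

lemma sum_walsh (s : HashRange l) : ∑ j, walsh s j = if s = 0 then (2 : ℝ) ^ l else 0 := by
  have h : ∑ j, walsh s j = ∏ i, ∑ b, signChar (s i * b) := by
    rw [prod_univ_sum, Fintype.piFinset_univ]; rfl
  rw [h]
  simp only [sum_signChar_mul]
  split_ifs with hs
  · simp [hs]
  · obtain ⟨i, hi⟩ : ∃ i, s i ≠ 0 := by
      by_contra! hc
      exact hs (funext hc)
    exact prod_eq_zero (mem_univ i) (if_neg hi)

lemma expect_walsh_mul (s s' : HashRange l) :
    𝔼 j, walsh s j * walsh s' j = if s = s' then 1 else 0 := by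
  have h : ∀ j, walsh s j * walsh s' j = walsh (s + s') j := fun j => by
    rw [walsh_comm s, walsh_comm s', ← walsh_add, walsh_comm]
  simp only [h]
  rw [Fintype.expect_eq_sum_div_card, sum_walsh, card_hashRange]
  simp only [add_eq_zero_iff_eq_hashRange]
  split_ifs <;> simp

/-- Parseval's identity. -/
lemma expect_sq_sum_walsh (f : HashRange l → ℝ) :
    𝔼 s, (∑ j, walsh s j * f j) ^ 2 = ∑ j, f j ^ 2 := by
  have h : ∀ s, (∑ j, walsh s j * f j) ^ 2 =
      ∑ j, ∑ k, (walsh j s * walsh k s) * (f j * f k) := by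
    intro s
    rw [sq, sum_mul_sum]
    refine sum_congr rfl fun j _ => sum_congr rfl fun k _ => ?_
    rw [walsh_comm s j, walsh_comm s k]; ring
  simp only [h, expect_sum_comm, ← expect_mul, expect_walsh_mul]
  simp [sq]

/-- The characters of the pair of a sign and a hash value. -/
noncomputable def signedWalsh (s : HashRange l) (t : ℤˣ × HashRange l) : ℝ :=
  ((t.1 : ℤ) : ℝ) * walsh s t.2

lemma units_cast_sq (e : ℤˣ) : ((e : ℤ) : ℝ) ^ 2 = 1 := by
  rcases Int.units_eq_one_or e with rfl | rfl <;> simp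

/-- The random sign supplies the oddness: negation fixes the hash value in characteristic 2, so it
flips only the sign. -/
lemma isSymmOrthonormal_signedWalsh :
    IsSymmOrthonormal (signedWalsh : HashRange l → ℤˣ × HashRange l → ℝ) where
  map_neg s t := by
    have h : -t.2 = t.2 := by
      have h2 : ∀ a : ZMod 2, -a = a := by decide
      exact funext fun i => h2 _
    simp [signedWalsh, h]
  sq_eq_one s t := by rw [signedWalsh, mul_pow, units_cast_sq, walsh_sq, one_mul]
  orthogonal s s' h := by
    have h1 : ∀ t : ℤˣ × HashRange l,
        signedWalsh s t * signedWalsh s' t = walsh s t.2 * walsh s' t.2 := fun t => by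
      rw [signedWalsh, signedWalsh]
      linear_combination (walsh s t.2 * walsh s' t.2) * units_cast_sq t.1
    simp only [h1]
    rw [← univ_product_univ, expect_product]
    simp [expect_walsh_mul, h]

variable {c : ℕ} {σ : Type*}

/-- The Walsh coefficients of a value function. -/
noncomputable def walshCoeff (v : Key c σ → HashRange l → ℝ) (s : HashRange l) (x : Key c σ) : ℝ :=
  ∑ j, walsh s j * v x j

lemma keyNorm_one (v : Key c σ → HashRange l → ℝ) (x : Key c σ) :
    keyNorm 1 v x = ∑ j, |v x j| := by
  simp [keyNorm, PiLp.norm_eq_of_L1]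

lemma keyNorm_two_sq (v : Key c σ → HashRange l → ℝ) (x : Key c σ) :
    keyNorm 2 v x ^ 2 = ∑ j, v x j ^ 2 := by
  simp [keyNorm, PiLp.norm_sq_eq_of_L2]

lemma keyNorm_nonneg (q : ℝ≥0∞) [Fact (1 ≤ q)] (v : Key c σ → HashRange l → ℝ) (x : Key c σ) :
    0 ≤ keyNorm q v x := norm_nonneg _

lemma walshCoeff_sq_le (v : Key c σ → HashRange l → ℝ) (s : HashRange l) (x : Key c σ) :
    walshCoeff v s x ^ 2 ≤ keyNorm 1 v x ^ 2 := by
  rw [sq_le_sq, abs_of_nonneg (keyNorm_nonneg 1 v x), keyNorm_one]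
  refine (abs_sum_le_sum_abs _ _).trans (le_of_eq (sum_congr rfl fun j _ => ?_))
  rw [abs_mul, abs_walsh, one_mul]

lemma keyNorm_one_sq_le (v : Key c σ → HashRange l → ℝ) (x : Key c σ) :
    keyNorm 1 v x ^ 2 ≤ 2 ^ l * keyNorm 2 v x ^ 2 := by
  rw [keyNorm_one, keyNorm_two_sq, ← card_hashRange]
  simpa using sq_sum_le_card_mul_sum_sq (s := univ) (f := fun j => |v x j|)

lemma keyNorm_two_sq_le (v : Key c σ → HashRange l → ℝ) (x : Key c σ) :
    keyNorm 2 v x ^ 2 ≤ keyNorm 1 v x ^ 2 := by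
  rw [keyNorm_one, keyNorm_two_sq]
  simpa using sum_sq_le_sq_sum_of_nonneg (s := univ) (f := fun j => |v x j|)
    fun j _ => abs_nonneg _

variable [Fintype σ]

lemma expect_sum_walshCoeff_sq (v : Key c σ → HashRange l → ℝ) :
    𝔼 s, ∑ x, walshCoeff v s x ^ 2 = ∑ x, keyNorm 2 v x ^ 2 := by
  rw [expect_sum_comm]
  exact sum_congr rfl fun x _ => by rw [keyNorm_two_sq, ← expect_sq_sum_walsh]; rfl

/-- Under the Walsh transform, the shift by `h(x)` becomes multiplication by a character, which
factors over the positions. -/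
lemma sumSquares_eq_expect (v : Key c σ → HashRange l → ℝ) (T : Fin c × σ → HashRange l)
    (E : Fin c × σ → ℤˣ) :
    sumSquares v T E =
      𝔼 s, (∑ x, (∏ i, signedWalsh s (E (i, x i), T (i, x i))) * walshCoeff v s x) ^ 2 := by
  rw [sumSquares, ← expect_sq_sum_walsh]
  refine expect_congr rfl fun s _ => ?_
  congr 1
  simp only [mul_sum]
  rw [sum_comm]
  refine sum_congr rfl fun x _ => ?_
  have h1 : ∏ i, signedWalsh s (E (i, x i), T (i, x i)) =
      ((simpleTabSign E x : ℤ) : ℝ) * walsh s (simpleTab T x) := by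
    rw [simpleTab, walsh_sum, simpleTabSign]
    push_cast
    rw [← prod_mul_distrib]; rfl
  rw [h1, walshCoeff, mul_sum]
  refine Fintype.sum_equiv (Equiv.addLeft (simpleTab T x)) _ _ fun j => ?_
  have h2 : walsh s j = walsh s (simpleTab T x) * walsh s (simpleTab T x + j) := by
    rw [walsh_add]
    linear_combination -walsh s j * walsh_sq s (simpleTab T x)
  rw [h2, Equiv.coe_addLeft]
  ring

end Walsh

/-! ### Choice of the parameter, and transfer to random tables -/

section Moments

/-- The choice of the parameter `u` of the moment bound for a chaos. -/
lemma exists_parameter {c : ℕ} (hc : 0 < c) {P m A B : ℝ} (hP : 2 ≤ P) (hm : 0 < m)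
    (hmP : Real.log m ≤ P) (hAB : A ≤ m * B) (hBA : B ≤ A) (hB : 0 ≤ B) :
    ∃ u, 1 ≤ u ∧ u ≤ P ∧ (400 * P) ^ c * (B / u ^ c + c * (Real.exp u * A / m)) ≤
      (7200 * c * P / Real.log (Real.exp 2 * m * B / A)) ^ c * B := by
  rcases hB.eq_or_lt with rfl | hB0
  · have hA : A = 0 := le_antisymm (by simpa using hAB) hBA
    exact ⟨1, le_rfl, by linarith, by simp [hA]⟩
  have hA0 : 0 < A := hB0.trans_le hBA
  set R := m * B / A with hR
  have hR0 : 0 < R := by positivity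
  have hR1 : 1 ≤ R := by rwa [hR, one_le_div hA0]
  have hRm : R ≤ m := by
    rw [hR, div_le_iff₀ hA0]; gcongr
  have hell : Real.log (Real.exp 2 * m * B / A) = 2 + Real.log R := by
    rw [mul_assoc, mul_div_assoc, Real.log_mul (Real.exp_pos 2).ne' hR0.ne', Real.log_exp]
  rw [hell]
  set ell := 2 + Real.log R with hl
  have hl2 : 2 ≤ ell := by linarith [Real.log_nonneg hR1]
  have hlP : ell ≤ 2 + P := by linarith [Real.log_le_log hR0 hRm]
  have hc1 : (1 : ℝ) ≤ c := by exact_mod_cast hc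
  have hexpl : Real.exp ell = Real.exp 2 * R := by rw [hl, Real.exp_add, Real.exp_log hR0]
  have he2 : Real.exp 2 ≤ 8 := by
    have h : Real.exp 2 = Real.exp 1 ^ 2 := by rw [← Real.exp_nat_mul]; norm_num
    rw [h]
    have := Real.exp_one_lt_d9
    nlinarith [Real.exp_pos 1]
  -- For `u = ell / (2c)`, `u^c e^u ≤ e^(2cu) = e^ell = e² R`, so the second term is comparable to
  -- the first. When the maximum is 1, `e ≤ e² R` suffices.
  set u := max 1 (ell / (2 * c)) with hu
  have hu1 : 1 ≤ u := le_max_left _ _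
  have hu0 : 0 < u := by linarith
  have hkey : u ^ c * Real.exp u ≤ Real.exp 2 * R := by
    rcases max_choice 1 (ell / (2 * c)) with h | h
    · rw [hu, h, one_pow, one_mul]
      calc Real.exp 1 ≤ Real.exp 2 := Real.exp_le_exp.2 (by norm_num)
        _ ≤ _ := le_mul_of_one_le_right (Real.exp_pos 2).le hR1
    · have hle : ell = c * u + c * u := by rw [hu, h]; field_simp; ring
      calc u ^ c * Real.exp u ≤ Real.exp u ^ c * Real.exp (c * u) := by
            gcongr
            · linarith [Real.add_one_le_exp u]
            · exact le_mul_of_one_le_left hu0.le hc1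
        _ = Real.exp ell := by rw [← Real.exp_nat_mul, ← Real.exp_add, ← hle]
        _ = _ := hexpl
  refine ⟨u, hu1, max_le (by linarith) ?_, ?_⟩
  · calc ell / (2 * c) ≤ ell / 2 := by gcongr; linarith
      _ ≤ P := by linarith
  · have h1 : Real.exp u * A / m ≤ 8 * (B / u ^ c) := by
      have h2 : Real.exp u ≤ 8 * R / u ^ c := by
        rw [le_div_iff₀ (by positivity), mul_comm]
        exact hkey.trans (by gcongr)
      calc Real.exp u * A / m ≤ 8 * R / u ^ c * A / m := by gcongr
        _ = _ := by rw [hR]; field_simp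
    have h3 : (1 : ℝ) + c * 8 ≤ 9 ^ c := by
      have := one_add_mul_le_pow (a := (8 : ℝ)) (by norm_num) c
      norm_num at this ⊢
      exact this
    have h4 : 1 / u ≤ 2 * c / ell := by
      have : ell / (2 * c) ≤ u := le_max_right _ _
      rw [div_le_div_iff₀ hu0 (by linarith), one_mul]
      rw [div_le_iff₀ (by positivity)] at this
      linarith
    calc (400 * P) ^ c * (B / u ^ c + c * (Real.exp u * A / m))
        ≤ (400 * P) ^ c * (B / u ^ c + c * (8 * (B / u ^ c))) := by gcongr
      _ = (400 * P) ^ c * ((1 + c * 8) * (1 / u) ^ c) * B := by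
          rw [div_pow, one_pow]; ring
      _ ≤ (400 * P) ^ c * (9 ^ c * (2 * c / ell) ^ c) * B := by gcongr
      -- The constant is `400 · 9 · 2 = 7200`.
      _ = _ := by
          rw [← mul_pow, ← mul_pow]
          congr 2
          ring

variable {c l : ℕ} {σ Ω : Type*} [Fintype σ] [MeasurableSpace Ω]

lemma sumSquares_nonneg (v : Key c σ → HashRange l → ℝ) (T : Fin c × σ → HashRange l)
    (E : Fin c × σ → ℤˣ) : 0 ≤ sumSquares v T E := sum_nonneg fun _ _ => sq_nonneg _

/-- The moment bound as a finite average over all pairs of tables. -/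
lemma exists_expect_sumSquares_rpow_le [DecidableEq σ] (hc : 0 < c) (v : Key c σ → HashRange l → ℝ)
    {P : ℝ} (hP : 2 ≤ P) (hl : Real.log (2 ^ l) ≤ P) :
    ∃ D, 0 ≤ D ∧
      D ≤ (7200 * c * P / Real.log (Real.exp 2 * 2 ^ l * (∑ x, keyNorm 2 v x ^ 2) /
        ∑ x, keyNorm 1 v x ^ 2)) ^ c * ∑ x, keyNorm 2 v x ^ 2 ∧
      𝔼 z : (Fin c × σ → HashRange l) × (Fin c × σ → ℤˣ), sumSquares v z.1 z.2 ^ P ≤ D ^ P := by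
  obtain ⟨u, hu1, huP, hu⟩ := exists_parameter hc hP (m := 2 ^ l)
    (A := ∑ x, keyNorm 1 v x ^ 2) (B := ∑ x, keyNorm 2 v x ^ 2) (by positivity) hl
    (by rw [mul_sum]; exact sum_le_sum fun x _ => keyNorm_one_sq_le v x)
    (sum_le_sum fun x _ => keyNorm_two_sq_le v x) (sum_nonneg fun _ _ => sq_nonneg _)
  have hcard : (Fintype.card (HashRange l) : ℝ) ≤ Real.exp P := by
    rw [card_hashRange]
    exact (Real.log_le_iff_le_exp (by positivity)).1 hl
  have h := isSymmOrthonormal_signedWalsh.expect_chaos_rpow_le (by linarith : 1 ≤ P) hu1 huP hcard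
    c (walshCoeff v) fun s => sum_le_sum fun x _ => walshCoeff_sq_le v s x
  rw [expect_sum_walshCoeff_sq, card_hashRange] at h
  let e : (Fin c × σ → HashRange l) × (Fin c × σ → ℤˣ) ≃ (Fin c → σ → ℤˣ × HashRange l) :=
    { toFun := fun z i α => (z.2 (i, α), z.1 (i, α))
      invFun := fun θ => (fun a => (θ a.1 a.2).2, fun a => (θ a.1 a.2).1)
      left_inv := fun _ => rfl
      right_inv := fun _ => rfl }
  have hA0 : 0 ≤ ∑ x, keyNorm 1 v x ^ 2 := sum_nonneg fun _ _ => sq_nonneg _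
  have hB0 : 0 ≤ ∑ x, keyNorm 2 v x ^ 2 := sum_nonneg fun _ _ => sq_nonneg _
  have hP0 : 0 < P := by linarith
  refine ⟨_, by positivity, hu, (le_of_eq ?_).trans h⟩
  refine Fintype.expect_equiv e _ _ fun z => ?_
  rw [sumSquares_eq_expect]
  rfl

/-- A moment of a function of a uniformly distributed random variable is a finite average. -/
lemma lintegral_rpow_enorm_comp {X : Type*} [Fintype X] [Nonempty X] [MeasurableSpace X]
    [MeasurableSingletonClass X] {μ : Measure Ω} {Z : Ω → X} (hZ : Measurable Z)
    (hunif : ∀ x, μ (Z ⁻¹' {x}) = (Fintype.card X : ℝ≥0∞)⁻¹) {g : X → ℝ} (hg : ∀ x, 0 ≤ g x)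
    {P : ℝ} (hP : 0 ≤ P) :
    ∫⁻ ω, ‖g (Z ω)‖ₑ ^ P ∂μ = ENNReal.ofReal (𝔼 x, g x ^ P) := by
  have h1 : ∀ x, ‖g x‖ₑ ^ P = ENNReal.ofReal (g x ^ P) := fun x => by
    rw [Real.enorm_of_nonneg (hg x), ENNReal.ofReal_rpow_of_nonneg (hg x) hP]
  rw [← lintegral_map (f := fun x => ‖g x‖ₑ ^ P) (measurable_of_finite _) hZ, lintegral_fintype,
    Fintype.expect_eq_sum_div_card, ENNReal.ofReal_div_of_pos (by exact_mod_cast Fintype.card_pos),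
    ENNReal.ofReal_sum_of_nonneg fun x _ => Real.rpow_nonneg (hg x) _, ENNReal.ofReal_natCast,
    div_eq_mul_inv, sum_mul]
  refine sum_congr rfl fun x _ => ?_
  rw [h1, Measure.map_apply hZ (measurableSet_singleton x), hunif]

instance : MeasurableSingletonClass ℤˣ where
  measurableSet_singleton e :=
    ⟨{(e : ℤ)}, measurableSet_singleton _, by ext; simp [Units.ext_iff]⟩

/-- The joint law of a fully random table. -/
lemma IsFullyRandom.measure_preimage_singleton {ι R : Type*} [Fintype ι] [DecidableEq ι]
    [Fintype R] [MeasurableSpace R] [MeasurableSingletonClass R] {μ : Measure Ω} {T : ι → Ω → R}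
    (hT : IsFullyRandom T μ) (t : ι → R) :
    μ ((fun ω a => T a ω) ⁻¹' {t}) = (Fintype.card (ι → R) : ℝ≥0∞)⁻¹ := by
  have h1 : (fun ω a => T a ω) ⁻¹' {t} = ⋂ a ∈ (univ : Finset ι), T a ⁻¹' {t a} := by
    ext ω; simp [funext_iff]
  rw [h1, hT.indep.measure_inter_preimage_eq_mul _ fun a _ => measurableSet_singleton _]
  simp only [hT.uniform, prod_const, card_univ, Fintype.card_fun, Nat.cast_pow, ENNReal.inv_pow]

lemma measure_preimage_tables [DecidableEq σ] {μ : Measure Ω} {T : Fin c × σ → Ω → HashRange l}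
    {E : Fin c × σ → Ω → ℤˣ} (hT : IsFullyRandom T μ) (hE : IsFullyRandom E μ)
    (hTE : IndepFun (fun ω a => T a ω) (fun ω a => E a ω) μ)
    (z : (Fin c × σ → HashRange l) × (Fin c × σ → ℤˣ)) :
    μ ((fun ω => ((fun a => T a ω), fun a => E a ω)) ⁻¹' {z}) =
      (Fintype.card ((Fin c × σ → HashRange l) × (Fin c × σ → ℤˣ)) : ℝ≥0∞)⁻¹ := by
  have h1 : (fun ω => ((fun a => T a ω), fun a => E a ω)) ⁻¹' {z} =
      (fun ω a => T a ω) ⁻¹' {z.1} ∩ (fun ω a => E a ω) ⁻¹' {z.2} := by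
    ext ω; simp [Prod.ext_iff]
  rw [h1, hTE.measure_inter_preimage_eq_mul _ _ (measurableSet_singleton _)
    (measurableSet_singleton _), hT.measure_preimage_singleton, hE.measure_preimage_singleton,
    Fintype.card_prod, Nat.cast_mul, ENNReal.mul_inv (by simp) (by simp)]

end Moments

end Tabulation

theorem mainTheorem11 :
    ∃ L : ℝ, 0 < L ∧
      ∀ (c l : ℕ) (_ : 0 < c) (σ : Type*) [Fintype σ]
        (v : Tabulation.Key c σ → Tabulation.HashRange l → ℝ)
        (Ω : Type*) [MeasurableSpace Ω] (μ : Measure Ω) [IsProbabilityMeasure μ]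
        (T : Fin c × σ → Ω → Tabulation.HashRange l) (E : Fin c × σ → Ω → ℤˣ),
        Tabulation.IsFullyRandom T μ →
        Tabulation.IsFullyRandom E μ →
        IndepFun (fun ω a => T a ω) (fun ω a => E a ω) μ →
        ∀ p : ℝ, 2 ≤ p →
          eLpNorm (fun ω => Tabulation.sumSquares v (fun a => T a ω) (fun a => E a ω))
              (ENNReal.ofReal p) μ ≤
            ENNReal.ofReal
              ((L * c * max p (Real.log ((2 : ℝ) ^ l)) /
                  Real.log (Real.exp 2 * (2 : ℝ) ^ l * (∑ x, Tabulation.keyNorm 2 v x ^ 2) /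
                    ∑ x, Tabulation.keyNorm 1 v x ^ 2)) ^ c *
                ∑ x, Tabulation.keyNorm 2 v x ^ 2) := by
  refine ⟨7200, by norm_num, ?_⟩
  intro c l hc σ _ v Ω _ μ _ T E hT hE hTE p hp
  classical
  -- The chaos bound needs `m ≤ e^P`. Raising the exponent from `p` to `P` only increases the norm
  -- on a probability space.
  set P := max p (Real.log ((2 : ℝ) ^ l)) with hP
  have hpP : p ≤ P := le_max_left _ _
  have hP2 : 2 ≤ P := hp.trans hpP
  have hP0 : 0 < P := by linarith
  set g : (Fin c × σ → Tabulation.HashRange l) × (Fin c × σ → ℤˣ) → ℝ :=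
    fun z => Tabulation.sumSquares v z.1 z.2 with hg
  have hg0 : ∀ z, 0 ≤ g z := fun z => Tabulation.sumSquares_nonneg v z.1 z.2
  set Z : Ω → (Fin c × σ → Tabulation.HashRange l) × (Fin c × σ → ℤˣ) :=
    fun ω => ((fun a => T a ω), fun a => E a ω) with hZdef
  have hZ : Measurable Z :=
    (measurable_pi_lambda _ hT.measurable).prodMk (measurable_pi_lambda _ hE.measurable)
  obtain ⟨D, hD0, hD, hmoment⟩ :=
    Tabulation.exists_expect_sumSquares_rpow_le hc v hP2 (le_max_right _ _)
  change eLpNorm (fun ω => g (Z ω)) (ENNReal.ofReal p) μ ≤ _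
  refine le_trans ?_ (ENNReal.ofReal_le_ofReal hD)
  have hmeas : AEStronglyMeasurable (fun ω => g (Z ω)) μ :=
    ((measurable_of_finite g).comp hZ).aestronglyMeasurable
  refine (eLpNorm_le_eLpNorm_of_exponent_le (ENNReal.ofReal_le_ofReal hpP) hmeas).trans ?_
  rw [eLpNorm_eq_lintegral_rpow_enorm_toReal (by simpa using hP0) ENNReal.ofReal_ne_top,
    ENNReal.toReal_ofReal hP0.le,
    Tabulation.lintegral_rpow_enorm_comp hZ
      (Tabulation.measure_preimage_tables hT hE hTE) hg0 hP0.le]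
  calc ENNReal.ofReal (Finset.expect Finset.univ (fun z => g z ^ P)) ^ (1 / P)
      ≤ ENNReal.ofReal (D ^ P) ^ (1 / P) :=
        ENNReal.rpow_le_rpow (ENNReal.ofReal_le_ofReal hmoment) (by positivity)
    _ = ENNReal.ofReal D := by
      rw [ENNReal.ofReal_rpow_of_nonneg (Real.rpow_nonneg hD0 _) (by positivity), one_div,
        Real.rpow_rpow_inv hD0 hP0.ne']
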